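/- A variety of universal algebras is called a Jónsson–Tarski variety if its theory contains a unique constant $0$ and a binary operation $+$ such that $x+0=x=0+x$; thus it is a pointed category with all finite limits. A point over an object $Y$ is a morphism $f\colon X\to Y$ with a chosen section $s\colon Y\to X$, $fs=1_Y$. A point $(f,s)$, with kernel $k\colon K\to X$ of $f$, is strong if the pair $(k,s)$ is jointly extremal-epimorphic (every monomorphism through which both $k$ and $s$ factor is an isomorphism), and stably strong if every pullback of it along any morphism $Z\to Y$ (with the induced section) is strong. An object $Y$ is protomodular if all points over $Y$ are stably strong. In a Jónsson–Tarski variety, a point $(f,s)$ with kernel $k\colon K\to X$ is a Schreier split epimorphism if for every $x\in X$ there is a unique $a\in K$ with $x=k(a)+s(f(x))$. Let $\mathcal S$ be the class of Schreier split epimorphisms; an object $X$ is $\mathcal S$-special if the point $(\pi_2\colon X\times X\to X,\ \langle 1_X,1_X\rangle)$ belongs to $\mathcal S$. Theorem. In Jónsson–Tarski varieties, the concepts of a protomodular object and of an $\mathcal S$-special object are independent: it is not true that in every Jónsson–Tarski variety every $\mathcal S$-special object is protomodular, and it is not true that in every Jónsson–Tarski variety every protomodular object is $\mathcal S$-special.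 More precisely: (1) In the variety of unitary magmas (a constant $0$ and a binary operation $+$ with $x+0=x=0+x$), the cyclic group $C_2=(\{0,1\},+)$ of order $2$ is $\mathcal S$-special but not protomodular. (2) Consider the variety of Heyting semilattices: it has a constant $\top$ and binary operations $\wedge,\rightarrow$ such that $(\wedge,\top)$ is a semilattice with top element, $x\rightarrow x=\top$, $x\wedge(x\rightarrow y)=x\wedge y$, $y\wedge(x\rightarrow y)=y$ and $x\rightarrow(y\wedge z)=(x\rightarrow y)\wedge(x\rightarrow z)$. It is a Jónsson–Tarski variety with $0=\top$ and $+=\wedge$. In it every object is protomodular, but not every object is $\mathcal S$-special. -/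

import Mathlib

open CategoryTheory CategoryTheory.Limits

universe v u

/-! ### Points, strong points and protomodular objects in a pointed finitely complete category -/

section Protomodular

variable {C : Type u} [Category.{v} C]

/-- Two morphisms with the same codomain are jointly extremal-epimorphic if every monomorphism
through which both of them factor is an isomorphism. -/
def JointlyExtremalEpi {A B X : C} (k : A ⟶ X) (s : B ⟶ X) : Prop :=
  ∀ ⦃M : C⦄ (m : M ⟶ X), Mono m →
    (∃ k' : A ⟶ M, k' ≫ m = k) → (∃ s' : B ⟶ M, s' ≫ m = s) → IsIso m

/-- A point over `Y`: a split epimorphism `f : X ⟶ Y` with a chosen section `s`. -/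
structure Point (Y : C) where
  X : C
  f : X ⟶ Y
  s : Y ⟶ X
  section_comp : s ≫ f = 𝟙 Y

variable [HasZeroMorphisms C] [HasFiniteLimits C]

/-- A point is strong if its kernel and its section are jointly extremal-epimorphic. -/
def Point.IsStrong {Y : C} (p : Point Y) : Prop :=
  JointlyExtremalEpi (kernel.ι p.f) p.s

/-- The pullback of a point along `g : Z ⟶ Y`, with the induced section. -/
noncomputable def Point.pullbackAlong {Y Z : C} (p : Point Y) (g : Z ⟶ Y) : Point Z where
  X := pullback g p.f
  f := pullback.fst g p.f
  s := pullback.lift (𝟙 Z) (g ≫ p.s) (by simp [p.section_comp])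
  section_comp := pullback.lift_fst _ _ _

/-- A point is stably strong if every pullback of it is strong. -/
def Point.IsStablyStrong {Y : C} (p : Point Y) : Prop :=
  ∀ ⦃Z : C⦄ (g : Z ⟶ Y), (p.pullbackAlong g).IsStrong

/-- An object is protomodular if all points over it are stably strong. -/
def IsProtomodularObject (Y : C) : Prop :=
  ∀ p : Point Y, p.IsStablyStrong

end Protomodular

/-! ### Varieties of universal algebras -/

/-- A (finitary, one-sorted) equational presentation: a language without relation symbols and a
set of equations between terms in countably many variables. -/
structure EquationalVariety where
  L : FirstOrder.Language.{u, u}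
  isAlgebraic : L.IsAlgebraic
  equations : Set (L.Term ℕ × L.Term ℕ)

namespace EquationalVariety

variable (V : EquationalVariety.{u})

instance : V.L.IsAlgebraic := V.isAlgebraic

/-- The structure `M` satisfies all the equations of the variety. -/
def Satisfied (M : Type u) [V.L.Structure M] : Prop :=
  ∀ e ∈ V.equations, ∀ x : ℕ → M, e.1.realize x = e.2.realize x

/-- The algebras of the variety. -/
structure Alg where
  carrier : Type u
  [str : V.L.Structure carrier]
  satisfied : V.Satisfied carrier

instance : CoeSort V.Alg (Type u) := ⟨Alg.carrier⟩

instance (M : V.Alg) : V.L.Structure M := M.str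

instance : Category V.Alg where
  Hom M N := V.L.Hom M N
  id M := FirstOrder.Language.Hom.id V.L M
  comp f g := g.comp f

instance : ConcreteCategory V.Alg (fun M N => V.L.Hom M N) where
  hom f := f
  ofHom f := f

variable {V}

/-- The limit of a small diagram of algebras: the compatible families, with pointwise operations. -/
abbrev LimitCarrier {J : Type u} [Category.{u} J] (F : J ⥤ V.Alg) : Type u :=
  { x : ∀ j, F.obj j // ∀ ⦃i j : J⦄ (a : i ⟶ j), F.map a (x i) = x j }

instance {J : Type u} [Category.{u} J] (F : J ⥤ V.Alg) : V.L.Structure (LimitCarrier F) where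
  funMap o x := ⟨fun j => FirstOrder.Language.Structure.funMap o (fun i => (x i).1 j), by
    intro i j a
    refine (FirstOrder.Language.Hom.map_fun
      (show V.L.Hom (F.obj i) (F.obj j) from F.map a) o _).trans ?_
    congr 1
    funext l
    exact (x l).2 a⟩
  RelMap r _ := isEmptyElim r

/-- The projections of the limit. -/
def limitProj {J : Type u} [Category.{u} J] (F : J ⥤ V.Alg) (j : J) :
    V.L.Hom (LimitCarrier F) (F.obj j) where
  toFun x := x.1 j
  map_fun' _ _ := rfl
  map_rel' r _ := isEmptyElim r

/-- The limit algebra. -/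
def limitAlg {J : Type u} [Category.{u} J] (F : J ⥤ V.Alg) : V.Alg where
  carrier := LimitCarrier F
  satisfied := by
    intro e he x
    apply Subtype.ext
    funext j
    have h1 := FirstOrder.Language.HomClass.realize_term (limitProj F j) (t := e.1) (v := x)
    have h2 := FirstOrder.Language.HomClass.realize_term (limitProj F j) (t := e.2) (v := x)
    exact h1.symm.trans (((F.obj j).satisfied e he _).trans h2)

/-- The limit cone. -/
def limitCone {J : Type u} [Category.{u} J] (F : J ⥤ V.Alg) : Cone F where
  pt := limitAlg F
  π :=
    { app := fun j => limitProj F j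
      naturality := by
        intro i j a
        apply FirstOrder.Language.Hom.ext
        intro x
        exact (x.2 a).symm }

/-- The limit cone is a limit. -/
def limitConeIsLimit {J : Type u} [Category.{u} J] (F : J ⥤ V.Alg) : IsLimit (limitCone F) where
  lift c :=
    { toFun := fun y => ⟨fun j => c.π.app j y, fun i j a => by
        exact congrArg (fun g : V.L.Hom c.pt (F.obj j) => g y) (c.w a)⟩
      map_fun' := fun o y => by
        apply Subtype.ext
        funext j
        exact FirstOrder.Language.Hom.map_fun (show V.L.Hom c.pt (F.obj j) from c.π.app j) o y
      map_rel' := fun r _ => isEmptyElim r }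
  fac _ _ := rfl
  uniq c m h := by
    apply FirstOrder.Language.Hom.ext
    intro y
    apply Subtype.ext
    funext j
    exact congrArg (fun g : V.L.Hom c.pt (F.obj j) => g y) (h j)

instance : HasLimits V.Alg where
  has_limits_of_shape _ _ := ⟨fun F => ⟨⟨⟨limitCone F, limitConeIsLimit F⟩⟩⟩⟩

end EquationalVariety

/-! ### Jónsson–Tarski varieties -/

/-- A Jónsson–Tarski variety: a variety whose theory contains a unique constant `0` (a closed term
such that any other closed term equals it in all algebras) and a binary operation `+` (a term in
two variables) such that `x + 0 = x = 0 + x` holds in all algebras. -/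
structure JonssonTarskiVariety where
  variety : EquationalVariety.{u}
  zero : variety.L.Term Empty
  add : variety.L.Term (Fin 2)
  unique_constant : ∀ (M : variety.Alg) (t : variety.L.Term Empty),
    t.realize (Empty.elim : Empty → M) = zero.realize Empty.elim
  add_zero : ∀ (M : variety.Alg) (x : M),
    add.realize ![x, zero.realize Empty.elim] = x
  zero_add : ∀ (M : variety.Alg) (x : M),
    add.realize ![zero.realize Empty.elim, x] = x

namespace JonssonTarskiVariety

variable (V : JonssonTarskiVariety.{u})

/-- The category of algebras of a Jónsson–Tarski variety. -/
abbrev Alg : Type (u + 1) := V.variety.Alg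

variable {V}

/-- The constant `0` of an algebra. -/
def zeroOf (M : V.Alg) : M := V.zero.realize Empty.elim

/-- The operation `+` of an algebra. -/
def plus {M : V.Alg} (x y : M) : M := V.add.realize ![x, y]

theorem funMap_zeroOf (M : V.Alg) {n : ℕ} (o : V.variety.L.Functions n) :
    FirstOrder.Language.Structure.funMap o (fun _ : Fin n => zeroOf M) = zeroOf M :=
  V.unique_constant M (FirstOrder.Language.Term.func o fun _ => V.zero)

theorem map_zeroOf {M N : V.Alg} (f : M ⟶ N) : f (zeroOf M) = zeroOf N := by
  have h := FirstOrder.Language.HomClass.realize_term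
    (show V.variety.L.Hom M N from f) (t := V.zero) (v := (Empty.elim : Empty → M))
  refine h.symm.trans ?_
  unfold zeroOf
  congr 1
  funext e
  exact e.elim

/-- The zero morphisms are the constant maps to `0`. -/
instance : HasZeroMorphisms V.Alg where
  zero M N := ⟨
    { toFun := fun _ => zeroOf N
      map_fun' := fun o _ => (funMap_zeroOf N o).symm
      map_rel' := fun r _ => isEmptyElim r }⟩
  comp_zero _ _ := rfl
  zero_comp M _ _ g := by
    apply FirstOrder.Language.Hom.ext
    intro x
    exact map_zeroOf g

/-- A point `(f, s)` in a Jónsson–Tarski variety, with kernel `k : K ⟶ X`, is a Schreier split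
epimorphism if for every `x` in `X` there is a unique `a` in `K` with `x = k a + s (f x)`. -/
def IsSchreier {Y : V.Alg} (p : Point Y) : Prop :=
  ∀ x : p.X, ∃! a : (kernel p.f : V.Alg), x = plus (kernel.ι p.f a) (p.s (p.f x))

/-- The point given by the second projection `X × X ⟶ X` and the diagonal. -/
noncomputable def diagonalPoint (X : V.Alg) : Point X where
  X := X ⨯ X
  f := prod.snd
  s := diag X
  section_comp := prod.lift_snd _ _

/-- Special objects with respect to the class of Schreier split epimorphisms. -/
def IsSchreierSpecial (X : V.Alg) : Prop :=
  IsSchreier (diagonalPoint X)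

end JonssonTarskiVariety

/-! ### Unitary magmas -/

/-- The operation symbols of unitary magmas: a constant and a binary operation. -/
inductive MagOp : ℕ → Type u
  | zero : MagOp 0
  | add : MagOp 2

/-- The language of unitary magmas. -/
def magLanguage : FirstOrder.Language.{u, u} := ⟨MagOp, fun _ => PEmpty⟩

namespace magLanguage

instance : magLanguage.{u}.IsAlgebraic := fun _ => inferInstanceAs (IsEmpty PEmpty)

/-- The symbol `0`. -/
abbrev zeroOp : magLanguage.{u}.Constants := MagOp.zero

/-- The symbol `+`. -/
abbrev addOp : magLanguage.{u}.Functions 2 := MagOp.add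

/-- The term `0`. -/
abbrev zeroT {α : Type} : magLanguage.{u}.Term α := zeroOp.term

/-- The term `s + t`. -/
abbrev addT {α : Type} (s t : magLanguage.{u}.Term α) : magLanguage.{u}.Term α := addOp.apply₂ s t

/-- The operations of a unitary magma. -/
@[reducible]
def structureOf (A : Type u) [AddZeroClass A] : magLanguage.{u}.Structure A where
  funMap {n} (o : MagOp n) :=
    match n, o with
    | _, MagOp.zero => fun _ => 0
    | _, MagOp.add => fun x => x 0 + x 1
  RelMap r _ := isEmptyElim r

theorem unique_constant (M : Type u) [magLanguage.{u}.Structure M]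
    (h : ∀ x : M, FirstOrder.Language.Structure.funMap addOp ![x, (zeroOp : M)] = x)
    (t : magLanguage.{u}.Term Empty) : t.realize (Empty.elim : Empty → M) = (zeroOp : M) := by
  induction t with
  | var e => exact e.elim
  | func o ts ih =>
    simp only [FirstOrder.Language.Term.realize, ih]
    cases o with
    | zero => exact congrArg _ (funext fun i => i.elim0)
    | add =>
      refine Eq.trans ?_ (h _)
      exact congrArg _ (funext fun i => by fin_cases i <;> rfl)

/-- The equations of unitary magmas: `x + 0 = x` and `0 + x = x`. -/
def equations : Set (magLanguage.{u}.Term ℕ × magLanguage.{u}.Term ℕ) :=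
  { (addT (.var 0) zeroT, .var 0),
    (addT zeroT (.var 0), .var 0) }

/-- The variety of unitary magmas. -/
def variety : EquationalVariety.{u} where
  L := magLanguage
  isAlgebraic := inferInstance
  equations := equations

theorem satisfied_iff (M : Type u) [inst : magLanguage.{u}.Structure M] :
    @EquationalVariety.Satisfied variety M inst ↔
      (∀ x : M, FirstOrder.Language.Structure.funMap addOp ![x, (zeroOp : M)] = x) ∧
      (∀ x : M, FirstOrder.Language.Structure.funMap addOp ![(zeroOp : M), x] = x) := by
  change (∀ e ∈ equations.{u}, ∀ x : ℕ → M, e.1.realize x = e.2.realize x) ↔ _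
  constructor
  · intro h
    constructor
    · intro x
      simpa using h _ (Or.inl rfl) (fun _ => x)
    · intro x
      simpa using h _ (Or.inr rfl) (fun _ => x)
  · rintro ⟨h1, h2⟩ e (rfl | rfl) x
    · simpa using h1 (x 0)
    · simpa using h2 (x 0)

/-- A unitary magma as an algebra of the variety. -/
def algOf (A : Type u) [AddZeroClass A] : variety.{u}.Alg :=
  letI := structureOf A
  { carrier := A
    str := structureOf A
    satisfied := (satisfied_iff A).2 ⟨fun x => add_zero x, fun x => zero_add x⟩ }

instance (M : variety.{u}.Alg) : magLanguage.{u}.Structure M := M.str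

end magLanguage

open magLanguage in
/-- Unitary magmas as a Jónsson–Tarski variety. -/
def Mag : JonssonTarskiVariety.{u} where
  variety := magLanguage.variety
  zero := zeroT
  add := addT (.var 0) (.var 1)
  unique_constant M t :=
    (unique_constant M ((satisfied_iff M).1 M.satisfied).1 t).trans
      FirstOrder.Language.Term.realize_constants.symm
  add_zero M x := by
    refine Eq.trans ?_ (((satisfied_iff M).1 M.satisfied).1 x)
    exact FirstOrder.Language.Term.realize_functions_apply₂.trans
      (congrArg (fun z : M => FirstOrder.Language.Structure.funMap addOp ![x, z])
        FirstOrder.Language.Term.realize_constants)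
  zero_add M x := by
    refine Eq.trans ?_ (((satisfied_iff M).1 M.satisfied).2 x)
    exact FirstOrder.Language.Term.realize_functions_apply₂.trans
      (congrArg (fun z : M => FirstOrder.Language.Structure.funMap addOp ![z, x])
        FirstOrder.Language.Term.realize_constants)

/-- The object of `Mag` given by a unitary magma. -/
def Mag.of (A : Type u) [AddZeroClass A] : Mag.{u}.Alg := magLanguage.algOf A

/-! ### Heyting semilattices -/

/-- The operation symbols of Heyting semilattices: `⊤`, `∧` and `→`. -/
inductive HSLatOp : ℕ → Type u
  | top : HSLatOp 0
  | inf : HSLatOp 2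
  | imp : HSLatOp 2

/-- The language of Heyting semilattices. -/
def hslatLanguage : FirstOrder.Language.{u, u} := ⟨HSLatOp, fun _ => PEmpty⟩

namespace hslatLanguage

instance : hslatLanguage.{u}.IsAlgebraic := fun _ => inferInstanceAs (IsEmpty PEmpty)

/-- The symbol `⊤`. -/
abbrev topOp : hslatLanguage.{u}.Constants := HSLatOp.top

/-- The symbol `∧`. -/
abbrev infOp : hslatLanguage.{u}.Functions 2 := HSLatOp.inf

/-- The symbol `→`. -/
abbrev impOp : hslatLanguage.{u}.Functions 2 := HSLatOp.imp

/-- The term `⊤`. -/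
abbrev topT {α : Type} : hslatLanguage.{u}.Term α := topOp.term

/-- The term `s ∧ t`. -/
abbrev infT {α : Type} (s t : hslatLanguage.{u}.Term α) : hslatLanguage.{u}.Term α :=
  infOp.apply₂ s t

/-- The term `s → t`. -/
abbrev impT {α : Type} (s t : hslatLanguage.{u}.Term α) : hslatLanguage.{u}.Term α :=
  impOp.apply₂ s t

theorem unique_constant (M : Type u) [hslatLanguage.{u}.Structure M]
    (h : ∀ x : M, FirstOrder.Language.Structure.funMap infOp ![x, (topOp : M)] = x)
    (h' : ∀ x : M, FirstOrder.Language.Structure.funMap impOp ![x, x] = (topOp : M))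
    (t : hslatLanguage.{u}.Term Empty) : t.realize (Empty.elim : Empty → M) = (topOp : M) := by
  induction t with
  | var e => exact e.elim
  | func o ts ih =>
    simp only [FirstOrder.Language.Term.realize, ih]
    cases o with
    | top => exact congrArg _ (funext fun i => i.elim0)
    | inf =>
      refine Eq.trans ?_ (h _)
      exact congrArg _ (funext fun i => by fin_cases i <;> rfl)
    | imp =>
      refine Eq.trans ?_ (h' (topOp : M))
      exact congrArg _ (funext fun i => by fin_cases i <;> rfl)

/-- The equations of Heyting semilattices: `∧` and `⊤` form a semilattice with top element, and
`x → x = ⊤`, `x ∧ (x → y) = x ∧ y`, `y ∧ (x → y) = y`, `x → (y ∧ z) = (x → y) ∧ (x → z)`. -/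
def equations : Set (hslatLanguage.{u}.Term ℕ × hslatLanguage.{u}.Term ℕ) :=
  { (infT (infT (.var 0) (.var 1)) (.var 2), infT (.var 0) (infT (.var 1) (.var 2))),
    (infT (.var 0) (.var 1), infT (.var 1) (.var 0)),
    (infT (.var 0) (.var 0), .var 0),
    (infT (.var 0) topT, .var 0),
    (impT (.var 0) (.var 0), topT),
    (infT (.var 0) (impT (.var 0) (.var 1)), infT (.var 0) (.var 1)),
    (infT (.var 1) (impT (.var 0) (.var 1)), .var 1),
    (impT (.var 0) (infT (.var 1) (.var 2)),
      infT (impT (.var 0) (.var 1)) (impT (.var 0) (.var 2))) }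

/-- The variety of Heyting semilattices. -/
def variety : EquationalVariety.{u} where
  L := hslatLanguage
  isAlgebraic := inferInstance
  equations := equations

instance (M : variety.{u}.Alg) : hslatLanguage.{u}.Structure M := M.str

theorem realize_eq (M : variety.{u}.Alg) :
    ∀ e ∈ equations.{u}, ∀ x : ℕ → M, e.1.realize x = e.2.realize x :=
  M.satisfied

theorem inf_comm (M : variety.{u}.Alg) (x y : M) :
    FirstOrder.Language.Structure.funMap infOp ![x, y] =
      FirstOrder.Language.Structure.funMap infOp ![y, x] := by
  simpa using realize_eq M _ (Or.inr (Or.inl rfl)) (fun n => if n = 0 then x else y)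

theorem inf_top (M : variety.{u}.Alg) (x : M) :
    FirstOrder.Language.Structure.funMap infOp ![x, (topOp : M)] = x := by
  simpa using realize_eq M _ (Or.inr (Or.inr (Or.inr (Or.inl rfl)))) (fun _ => x)

theorem imp_self (M : variety.{u}.Alg) (x : M) :
    FirstOrder.Language.Structure.funMap impOp ![x, x] = (topOp : M) := by
  simpa using realize_eq M _ (Or.inr (Or.inr (Or.inr (Or.inr (Or.inl rfl))))) (fun _ => x)

end hslatLanguage

open hslatLanguage in
/-- Heyting semilattices as a Jónsson–Tarski variety, with `0 = ⊤` and `+ = ∧`. -/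
def HSLat : JonssonTarskiVariety.{u} where
  variety := hslatLanguage.variety
  zero := topT
  add := infT (.var 0) (.var 1)
  unique_constant M t :=
    (unique_constant M (inf_top M) (imp_self M) t).trans
      FirstOrder.Language.Term.realize_constants.symm
  add_zero M x := by
    refine Eq.trans ?_ (inf_top M x)
    exact FirstOrder.Language.Term.realize_functions_apply₂.trans
      (congrArg (fun z : M => FirstOrder.Language.Structure.funMap infOp ![x, z])
        FirstOrder.Language.Term.realize_constants)
  zero_add M x := by
    refine Eq.trans ?_ ((inf_comm M _ _).trans (inf_top M x))
    exact FirstOrder.Language.Term.realize_functions_apply₂.trans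
      (congrArg (fun z : M => FirstOrder.Language.Structure.funMap infOp ![z, x])
        FirstOrder.Language.Term.realize_constants)

/-!
The limits of a variety are computed on underlying sets, so that kernels, products and monomorphisms
can be handled elementwise (`exists_kernel_ι_eq`, `injective_of_mono`). In particular an object `X`
of a Jónsson–Tarski variety is Schreier special exactly when every equation `x = a + y` has a unique
solution `a` in `X` (`isSchreierSpecial_iff`): the first projection identifies the kernel of
`π₂ : X × X ⟶ X` with `X`.

* Every group, in particular `C₂`, is therefore Schreier special as a unitary magma. It is not
  protomodular: there is a split epimorphism of unitary magmas onto `C₂` with trivial kernel which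
  is not injective (`SquareZero.point`), and the section of such a point is a proper subobject
  containing both the kernel and the section (`not_isProtomodularObject_of_point`).
* In a Heyting semilattice with a bottom element `⊥ ≠ ⊤`, the equation `⊤ = a ∧ ⊥` has no solution,
  so such an object is not Schreier special. On the other hand, with `u = x → y`, the identity
  `x = (u → y) ∧ ((u → y) → x)` (`eq_inf_imp`), applied to `y = s (f x)` for a point `(f, s)`,
  expresses `x` through `y` and the two elements `u` and `(u → y) → x` of the kernel of `f`. Hence
  every point is strong; as pullbacks of points are points, every object is protomodular.
-/

/-! ### Elements of limits in a variety -/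

namespace EquationalVariety

variable {V : EquationalVariety.{u}}

open FirstOrder.Language in
theorem map_realize {M N : V.Alg} (f : M ⟶ N) {α : Type} (t : V.L.Term α) (v : α → M) :
    f (t.realize v) = t.realize (fun i => f (v i)) :=
  (HomClass.realize_term (show V.L.Hom M N from f) (t := t) (v := v)).symm

instance : PreservesLimits (forget V.Alg) where
  preservesLimitsOfShape :=
    { preservesLimit := fun {F} =>
        preservesLimit_of_preserves_limit_cone (limitConeIsLimit F) <|
          ((Types.isLimit_iff ((forget V.Alg).mapCone (limitCone F))).2 fun s hs =>
            ⟨(⟨s, fun _ _ a => hs a⟩ : LimitCarrier F), fun _ => rfl, fun _ hx =>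
              Subtype.ext (funext hx)⟩).some }

instance : PreservesFiniteLimits (forget V.Alg) := inferInstance

theorem injective_of_mono {M N : V.Alg} (m : M ⟶ N) [Mono m] : Function.Injective m :=
  ConcreteCategory.injective_of_mono_of_preservesPullback m

theorem isIso_of_bijective {M N : V.Alg} (m : M ⟶ N) (hm : Function.Bijective m) : IsIso m := by
  let e : M ≃ N := Equiv.ofBijective m hm
  have he : ∀ y, m (e.symm y) = y := e.apply_symm_apply
  have he' : ∀ x, e.symm (m x) = x := e.symm_apply_apply
  let g : V.L.Hom N M :=
    { toFun := e.symm
      map_fun' := fun o y => by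
        apply hm.1
        rw [he]
        refine Eq.trans ?_ (FirstOrder.Language.Hom.map_fun (show V.L.Hom M N from m) o _).symm
        congr 1
        funext i
        exact (he (y i)).symm
      map_rel' := fun r _ => isEmptyElim r }
  exact ⟨g, FirstOrder.Language.Hom.ext he', FirstOrder.Language.Hom.ext he⟩

end EquationalVariety

/-! ### Kernels, special and protomodular objects in Jónsson–Tarski varieties -/

namespace JonssonTarskiVariety

open EquationalVariety

variable {V : JonssonTarskiVariety.{u}}

theorem map_plus {M N : V.Alg} (f : M ⟶ N) (x y : M) : f (plus x y) = plus (f x) (f y) := by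
  refine (map_realize f V.add ![x, y]).trans ?_
  unfold plus
  congr 1
  funext i
  fin_cases i <;> rfl

theorem exists_kernel_ι_eq {M N : V.Alg} (f : M ⟶ N) (x : M) (hx : f x = zeroOf N) :
    ∃ a : (kernel f : V.Alg), kernel.ι f a = x :=
  (Types.unique_of_type_equalizer _ _
    (isLimitForkMapOfIsLimit (forget V.Alg) _ (kernelIsKernel f)) x hx).exists

theorem map_kernel_ι {M N : V.Alg} (f : M ⟶ N) (a : (kernel f : V.Alg)) :
    f (kernel.ι f a) = zeroOf N :=
  ConcreteCategory.congr_hom (kernel.condition f) a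

theorem kernel_ι_injective {M N : V.Alg} (f : M ⟶ N) : Function.Injective (kernel.ι f) :=
  injective_of_mono _

/-- Schreier special objects are those in which `+` has unique right-hand differences: the kernel of
`π₂ : X × X ⟶ X` consists of the pairs `(a, 0)`. -/
theorem isSchreierSpecial_iff (X : V.Alg) :
    IsSchreierSpecial X ↔ ∀ x y : X, ∃! a : X, x = plus a y := by
  have diag_fst (y : X) : prod.fst (X := X) (Y := X) (diag X y) = y :=
    ConcreteCategory.congr_hom (prod.lift_fst (𝟙 X) (𝟙 X)) y
  have diag_snd (y : X) : prod.snd (X := X) (Y := X) (diag X y) = y :=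
    ConcreteCategory.congr_hom (prod.lift_snd (𝟙 X) (𝟙 X)) y
  have hext (z w : (X ⨯ X : V.Alg))
      (h1 : prod.fst (X := X) (Y := X) z = prod.fst (X := X) (Y := X) w)
      (h2 : prod.snd (X := X) (Y := X) z = prod.snd (X := X) (Y := X) w) : z = w := by
    apply (Concrete.prodEquiv X X).injective
    ext
    · simpa using h1
    · simpa using h2
  let ι := kernel.ι (prod.snd (X := X) (Y := X))
  have snd_ι (a) : prod.snd (X := X) (Y := X) (ι a) = zeroOf X :=
    map_kernel_ι (prod.snd (X := X) (Y := X)) a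
  have hbij : Function.Bijective fun a => prod.fst (X := X) (Y := X) (ι a) := by
    refine ⟨fun a b hab => ?_, fun x => ?_⟩
    · exact kernel_ι_injective _ (hext _ _ hab ((snd_ι a).trans (snd_ι b).symm))
    · obtain ⟨a, ha⟩ := exists_kernel_ι_eq (prod.snd (X := X) (Y := X))
        ((Concrete.prodEquiv X X).symm (x, zeroOf X)) (by simp)
      refine ⟨a, ?_⟩
      change prod.fst (X := X) (Y := X) (kernel.ι (prod.snd (X := X) (Y := X)) a) = x
      rw [ha]
      simp
  have key (z : (X ⨯ X : V.Alg)) (a) :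
      z = plus (ι a) (diag X (prod.snd (X := X) (Y := X) z)) ↔
        prod.fst (X := X) (Y := X) z =
          plus (prod.fst (X := X) (Y := X) (ι a)) (prod.snd (X := X) (Y := X) z) := by
    refine ⟨fun h => ?_, fun h => hext _ _ ?_ ?_⟩
    · refine (congrArg (prod.fst (X := X) (Y := X)) h).trans ?_
      rw [map_plus, diag_fst]
    · rw [map_plus, diag_fst, h]
    · rw [map_plus, diag_snd, snd_ι]
      exact (V.zero_add X _).symm
  have main (z : (X ⨯ X : V.Alg)) :
      (∃! a, z = plus (ι a) (diag X (prod.snd (X := X) (Y := X) z))) ↔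
        ∃! a : X, prod.fst (X := X) (Y := X) z = plus a (prod.snd (X := X) (Y := X) z) := by
    rw [hbij.existsUnique_iff]
    simp only [key]
  refine ⟨fun h x y => ?_, fun h z => (main z).2 (h _ _)⟩
  simpa using (main ((Concrete.prodEquiv X X).symm (x, y))).1 (h _)

/-- A point with trivial kernel whose underlying map is not injective is not strong: its section is
a monomorphism through which the kernel and the section factor, but is not an isomorphism. Strength is
tested on the pullback of the point along the identity. -/
theorem not_isProtomodularObject_of_point {Y : V.Alg} (p : Point Y)
    (h0 : ∀ x : p.X, p.f x = zeroOf Y → x = zeroOf p.X) (hf : ¬ Function.Injective p.f) :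
    ¬ IsProtomodularObject Y := by
  intro h
  have hk : kernel.ι (p.pullbackAlong (𝟙 Y)).f = 0 := by
    apply pullback.hom_ext
    · exact (kernel.condition (p.pullbackAlong (𝟙 Y)).f).trans zero_comp.symm
    · apply FirstOrder.Language.Hom.ext
      intro a
      refine (h0 _ ?_).trans (map_zeroOf (pullback.snd (𝟙 Y) p.f)).symm
      refine (ConcreteCategory.congr_hom (pullback.condition (f := 𝟙 Y) (g := p.f)) _).symm.trans ?_
      exact map_kernel_ι (p.pullbackAlong (𝟙 Y)).f a
  have hsf := (p.pullbackAlong (𝟙 Y)).section_comp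
  -- The section is itself the monomorphism through which the zero kernel and the section factor.
  have hs : IsIso (p.pullbackAlong (𝟙 Y)).s :=
    h p (𝟙 Y) _ (SplitMono.mono ⟨_, hsf⟩) ⟨0, by rw [hk, zero_comp]⟩ ⟨𝟙 _, Category.id_comp _⟩
  have : IsIso (pullback.fst (𝟙 Y) p.f) := by
    change IsIso (p.pullbackAlong (𝟙 Y)).f
    rw [← IsIso.inv_eq_of_hom_inv_id hsf]
    infer_instance
  have : IsIso p.f := by
    have : IsIso (pullback.snd (𝟙 Y) p.f ≫ p.f) := by
      rw [← pullback.condition]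
      infer_instance
    exact IsIso.of_isIso_comp_left (pullback.snd (𝟙 Y) p.f) _
  exact hf (injective_of_mono p.f)

theorem isProtomodularObject_of_forall_isStrong (h : ∀ {Z : V.Alg} (p : Point Z), p.IsStrong)
    (Y : V.Alg) : IsProtomodularObject Y :=
  fun p _ g => h (p.pullbackAlong g)

end JonssonTarskiVariety

/-! ### Unitary magmas and the cyclic group of order two -/

namespace Mag

open JonssonTarskiVariety

theorem zeroOf_of (A : Type u) [AddZeroClass A] : zeroOf (V := Mag) (Mag.of A) = (0 : A) :=
  FirstOrder.Language.Term.realize_constants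

theorem plus_of {A : Type u} [AddZeroClass A] (x y : A) :
    plus (V := Mag) (M := Mag.of A) x y = x + y :=
  FirstOrder.Language.Term.realize_functions_apply₂

/-- The morphism of `Mag` given by a homomorphism of unitary magmas. -/
def map {A B : Type u} [AddZeroClass A] [AddZeroClass B] (f : A →+ B) : Mag.of A ⟶ Mag.of B :=
  letI := magLanguage.structureOf A
  letI := magLanguage.structureOf B
  show magLanguage.Hom A B from
  { toFun := f
    map_fun' := fun o x => by
      cases o with
      | zero => exact f.map_zero
      | add => exact f.map_add (x 0) (x 1)
    map_rel' := fun r _ => isEmptyElim r }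

theorem isSchreierSpecial_of (A : Type u) [AddGroup A] :
    IsSchreierSpecial (V := Mag) (Mag.of A) := by
  rw [isSchreierSpecial_iff]
  have h (x y : A) : ∃! a : A, x = a + y :=
    ⟨x - y, (sub_add_cancel x y).symm, fun a ha => eq_sub_of_add_eq ha.symm⟩
  simp only [← plus_of] at h
  exact h

/-- The underlying set `{0, a, b}` of the unitary magma in which all sums of nonzero elements are
`0`. -/
inductive SquareZero : Type u
  | zero : SquareZero
  | a : SquareZero
  | b : SquareZero

namespace SquareZero

instance : AddZeroClass SquareZero.{u} where
  zero := .zero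
  add
    | .zero, y => y
    | x, .zero => x
    | _, _ => .zero
  zero_add _ := rfl
  add_zero x := by cases x <;> rfl

/-- The homomorphism onto the cyclic group of order two sending both `a` and `b` to `1`. -/
def toZModTwo : SquareZero.{u} →+ ULift.{u} (ZMod 2) where
  toFun
    | .zero => ⟨0⟩
    | _ => ⟨1⟩
  map_zero' := rfl
  map_add' x y := by cases x <;> cases y <;> rfl

/-- The section of `toZModTwo` with image `{0, a}`. -/
def ofZModTwo : ULift.{u} (ZMod 2) →+ SquareZero.{u} where
  toFun x := if x.down = 0 then .zero else .a
  map_zero' := rfl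
  map_add' := by
    rintro ⟨x⟩ ⟨y⟩
    fin_cases x <;> fin_cases y <;> rfl

/-- The point over `C₂` given by `toZModTwo` and `ofZModTwo`. Its kernel is trivial. -/
def point : Point (Mag.of (ULift.{u} (ZMod 2))) where
  X := Mag.of SquareZero
  f := Mag.map toZModTwo
  s := Mag.map ofZModTwo
  section_comp := by
    apply FirstOrder.Language.Hom.ext
    rintro ⟨x⟩
    fin_cases x <;> rfl

end SquareZero

theorem not_isProtomodularObject_zmod_two :
    ¬ IsProtomodularObject (Mag.of (ULift.{u} (ZMod 2))) := by
  refine not_isProtomodularObject_of_point (V := Mag) SquareZero.point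
    (fun (x : SquareZero) hx => ?_) fun h => ?_
  · rw [zeroOf_of] at hx
    refine Eq.trans ?_ (zeroOf_of SquareZero).symm
    replace hx : SquareZero.toZModTwo x = 0 := hx
    cases x with
    | zero => rfl
    | a => exact absurd (congrArg ULift.down hx) one_ne_zero
    | b => exact absurd (congrArg ULift.down hx) one_ne_zero
  · have h' : Function.Injective SquareZero.toZModTwo.{u} := h
    exact SquareZero.noConfusion (@h' .a .b rfl)

end Mag

/-! ### Heyting semilattices -/

namespace hslatLanguage

variable {M N : variety.{u}.Alg}

/-- The operation `∧` of a Heyting semilattice. -/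
def inf (x y : M) : M := FirstOrder.Language.Structure.funMap infOp ![x, y]

/-- The operation `→` of a Heyting semilattice. -/
def imp (x y : M) : M := FirstOrder.Language.Structure.funMap impOp ![x, y]

theorem map_inf (f : M ⟶ N) (x y : M) : f (inf x y) = inf (f x) (f y) := by
  refine (FirstOrder.Language.Hom.map_fun (show variety.L.Hom M N from f) infOp _).trans ?_
  unfold inf
  congr 1
  funext i
  fin_cases i <;> rfl

theorem map_imp (f : M ⟶ N) (x y : M) : f (imp x y) = imp (f x) (f y) := by
  refine (FirstOrder.Language.Hom.map_fun (show variety.L.Hom M N from f) impOp _).trans ?_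
  unfold imp
  congr 1
  funext i
  fin_cases i <;> rfl

theorem inf_assoc' (x y z : M) : inf (inf x y) z = inf x (inf y z) := by
  simpa [inf] using realize_eq M _ (Or.inl rfl)
    (fun n => if n = 0 then x else if n = 1 then y else z)

theorem inf_comm' (x y : M) : inf x y = inf y x := inf_comm M x y

theorem inf_top' (x : M) : inf x (topOp : M) = x := inf_top M x

theorem imp_self' (x : M) : imp x x = (topOp : M) := imp_self M x

theorem inf_imp (x y : M) : inf x (imp x y) = inf x y := by
  simpa [inf, imp] using realize_eq M _ (Or.inr (Or.inr (Or.inr (Or.inr (Or.inr (Or.inl rfl))))))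
    (fun n => if n = 0 then x else y)

theorem inf_imp_right (x y : M) : inf y (imp x y) = y := by
  simpa [inf, imp] using realize_eq M _
    (Or.inr (Or.inr (Or.inr (Or.inr (Or.inr (Or.inr (Or.inl rfl)))))))
    (fun n => if n = 0 then x else y)

theorem imp_inf (x y z : M) : imp x (inf y z) = inf (imp x y) (imp x z) := by
  simpa [inf, imp] using realize_eq M _
    (Or.inr (Or.inr (Or.inr (Or.inr (Or.inr (Or.inr (Or.inr rfl)))))))
    (fun n => if n = 0 then x else if n = 1 then y else z)

theorem top_imp (x : M) : imp (topOp : M) x = x := by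
  rw [← inf_top' (imp (topOp : M) x), inf_comm', inf_imp, inf_comm', inf_top']

/-- In order-theoretic terms, `x ≤ (x → y) → y`. -/
theorem inf_imp_imp (x y : M) : inf x (imp (imp x y) y) = x := by
  -- In order-theoretic terms, `u → x ≤ u → y` for `u = x → y`: as `u → u = ⊤`, the element `u → x`
  -- equals `u → (x ∧ u)`, and `x ∧ u = x ∧ y`.
  have h : inf (imp (imp x y) x) (imp (imp x y) y) = imp (imp x y) x := by
    rw [← imp_inf, ← inf_imp x y, imp_inf, imp_self', inf_top']
  calc inf x (imp (imp x y) y)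
      = inf (inf x (imp (imp x y) x)) (imp (imp x y) y) := by rw [inf_imp_right]
    _ = x := by rw [inf_assoc', h, inf_imp_right]

/-- With `u = x → y`, this reads `(u → y) ∧ ((u → y) → x) = x`. If `x` and `y` have the same image
under a homomorphism, then `u` and `(u → y) → x` are in its kernel. -/
theorem eq_inf_imp (x y : M) :
    inf (imp (imp x y) y) (imp (imp (imp x y) y) x) = x := by
  rw [inf_imp, inf_comm', inf_imp_imp]

/-- A subalgebra containing the kernel and the image of a section of `f` is everything. -/
theorem surjective_of_kernel_of_section {X Y : variety.{u}.Alg} (m : M ⟶ X) (f : X ⟶ Y)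
    (s : Y → X) (hfs : ∀ y, f (s y) = y) (hs : ∀ y, ∃ c, m c = s y)
    (hker : ∀ x, f x = (topOp : Y) → ∃ c, m c = x) : Function.Surjective m := by
  intro x
  have hu : f (imp x (s (f x))) = (topOp : Y) := by
    rw [map_imp, hfs, imp_self']
  have hv : f (imp (imp (imp x (s (f x))) (s (f x))) x) = (topOp : Y) := by
    rw [map_imp, map_imp, hu, hfs, top_imp, imp_self']
  obtain ⟨c, hc⟩ := hker _ hu
  obtain ⟨d, hd⟩ := hker _ hv
  obtain ⟨e, he⟩ := hs (f x)
  refine ⟨inf (imp c e) d, ?_⟩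
  rw [hslatLanguage.map_inf, map_imp, hc, hd, he, eq_inf_imp]

end hslatLanguage

namespace HSLat

open JonssonTarskiVariety hslatLanguage

theorem zeroOf_eq (M : hslatLanguage.variety.{u}.Alg) :
    zeroOf (V := HSLat) M = (topOp : M) :=
  FirstOrder.Language.Term.realize_constants (L := hslatLanguage) (M := M)

theorem isStrong {Y : HSLat.{u}.Alg} (p : Point Y) : p.IsStrong := by
  intro M m hm ⟨k', hk⟩ ⟨s', hs⟩
  refine EquationalVariety.isIso_of_bijective m
    ⟨EquationalVariety.injective_of_mono (V := HSLat.variety) m, ?_⟩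
  refine surjective_of_kernel_of_section m p.f p.s
    (fun y => ConcreteCategory.congr_hom p.section_comp y)
    (fun y => ⟨s' y, ConcreteCategory.congr_hom hs y⟩) fun x hx => ?_
  obtain ⟨a, rfl⟩ := exists_kernel_ι_eq p.f x (hx.trans (zeroOf_eq Y).symm)
  exact ⟨k' a, ConcreteCategory.congr_hom hk a⟩

/-- The operations of a generalized Heyting algebra, as a Heyting semilattice. -/
@[reducible]
def structureOf (A : Type u) [GeneralizedHeytingAlgebra A] : hslatLanguage.{u}.Structure A where
  funMap {n} (o : HSLatOp n) :=
    match n, o with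
    | _, HSLatOp.top => fun _ => ⊤
    | _, HSLatOp.inf => fun x => x 0 ⊓ x 1
    | _, HSLatOp.imp => fun x => x 0 ⇨ x 1
  RelMap r _ := isEmptyElim r

/-- The object of `HSLat` given by a generalized Heyting algebra. -/
def of (A : Type u) [GeneralizedHeytingAlgebra A] : HSLat.{u}.Alg :=
  letI := structureOf A
  { carrier := A
    str := structureOf A
    satisfied := by
      have ht : ((topOp : hslatLanguage.{u}.Constants) : A) = ⊤ := rfl
      have hi (x y : A) : FirstOrder.Language.Structure.funMap infOp ![x, y] = x ⊓ y := rfl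
      have hm (x y : A) : FirstOrder.Language.Structure.funMap impOp ![x, y] = x ⇨ y := rfl
      change ∀ e ∈ equations.{u}, ∀ x : ℕ → A, e.1.realize x = e.2.realize x
      rintro e (rfl | rfl | rfl | rfl | rfl | rfl | rfl | rfl) x <;>
        simp [ht, hi, hm, inf_assoc, _root_.inf_comm, himp_inf_distrib] }

theorem plus_of {A : Type u} [GeneralizedHeytingAlgebra A] (x y : A) :
    plus (V := HSLat) (M := HSLat.of A) x y = (x ⊓ y : A) :=
  FirstOrder.Language.Term.realize_functions_apply₂

theorem not_isSchreierSpecial_of (A : Type u) [HeytingAlgebra A] [Nontrivial A] :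
    ¬ IsSchreierSpecial (V := HSLat) (HSLat.of A) := by
  rw [isSchreierSpecial_iff]
  intro h
  obtain ⟨a, ha, -⟩ := h (⊤ : A) (⊥ : A)
  refine top_ne_bot (α := A) ?_
  exact ha.trans ((plus_of (A := A) a ⊥).trans (inf_bot_eq (α := A) a))

end HSLat

open JonssonTarskiVariety in
theorem mainTheorem3 :
    (¬ ∀ (V : JonssonTarskiVariety.{u}) (X : V.Alg),
        IsSchreierSpecial X → IsProtomodularObject X) ∧
    (¬ ∀ (V : JonssonTarskiVariety.{u}) (X : V.Alg),
        IsProtomodularObject X → IsSchreierSpecial X) ∧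
    (IsSchreierSpecial (V := Mag) (Mag.of (ULift.{u} (ZMod 2))) ∧
      ¬ IsProtomodularObject (Mag.of (ULift.{u} (ZMod 2)))) ∧
    (∀ Y : HSLat.{u}.Alg, IsProtomodularObject Y) ∧
    (∃ Y : HSLat.{u}.Alg, ¬ IsSchreierSpecial (V := HSLat) Y) := by
  have hC2 : IsSchreierSpecial (V := Mag) (Mag.of (ULift.{u} (ZMod 2))) :=
    Mag.isSchreierSpecial_of _
  have hHeyting : ∀ Y : HSLat.{u}.Alg, IsProtomodularObject Y :=
    isProtomodularObject_of_forall_isStrong HSLat.isStrong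
  have hBool : ¬ IsSchreierSpecial (V := HSLat) (HSLat.of (Set PUnit.{u + 1})) :=
    HSLat.not_isSchreierSpecial_of _
  exact ⟨fun h => Mag.not_isProtomodularObject_zmod_two (h Mag _ hC2),
    fun h => hBool (h HSLat _ (hHeyting _)),
    ⟨hC2, Mag.not_isProtomodularObject_zmod_two⟩, hHeyting, _, hBool⟩
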